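/- A relative c.e. operator is a computably enumerable set $\Theta$ of pairs $(\sigma,x)\in\omega^{<\omega}\times\omega$; for $g\in\omega^\omega$ we let $\Theta(g)$ be the set of all $x\in\omega$ such that $(\sigma,x)\in\Theta$ for some finite initial segment $\sigma$ of $g$. For $f,g\in\omega^\omega$ we write $g\ge f$ if $g(n)\ge f(n)$ for all $n\in\omega$. A set $A\subseteq\omega$ is (lightface) $\Pi^1_1$ if there is an arithmetical relation $P\subseteq\omega\times\omega^\omega$ such that $n\in A \iff (\forall h\in\omega^\omega)\,P(n,h)$ for all $n\in\omega$. Proposition. The following are equivalent for a set $A\subseteq\omega$: 1. There are a function $f\in\omega^\omega$ and a relative c.e. operator $\Theta$ such that $\Theta(g)=A$ for every $g\in\omega^\omega$ with $g\ge f$ (that is, $A$ has a uniform c.e. modulus). 2. $A$ is $\Pi^1_1$. -/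

import Mathlib

/-- A relative c.e. operator on Baire space: a computably enumerable set of pairs `(σ, x)`, where
`σ` is a finite string of natural numbers and `x` is a natural number. -/
structure RelCEOperator where
  pairs : Set (List ℕ × ℕ)
  ce : REPred (fun p : List ℕ × ℕ => p ∈ pairs)

/-- The initial segment `(g 0, …, g (k - 1))` of `g` of length `k`. -/
def initSeg (g : ℕ → ℕ) (k : ℕ) : List ℕ := (List.range k).map g

/-- The set `Θ(g)` of all `x` such that `(σ, x) ∈ Θ` for some initial segment `σ` of `g`. -/
def RelCEOperator.eval (Θ : RelCEOperator) (g : ℕ → ℕ) : Set ℕ :=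
  {x | ∃ k, (initSeg g k, x) ∈ Θ.pairs}

/-- The (lightface) arithmetical hierarchy of relations `P ⊆ ω × ω^ω`; `SigmaZero k` is the class
`Σ⁰_{k+1}`. A relation is `Σ⁰₁` if it is `{(n, h) | n ∈ Θ(h)}` for a relative c.e. operator `Θ`, and
`Σ⁰_{k+2}` if it is obtained from a `Π⁰_{k+1}` relation (the negation of a `Σ⁰_{k+1}` one) by an
existential number quantifier. -/
def SigmaZero : ℕ → (ℕ → (ℕ → ℕ) → Prop) → Prop
  | 0, P => ∃ Θ : RelCEOperator, ∀ n h, P n h ↔ n ∈ Θ.eval h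
  | k + 1, P => ∃ Q, SigmaZero k Q ∧ ∀ n h, P n h ↔ ∃ m, ¬ Q (Nat.pair n m) h

/-- A relation `P ⊆ ω × ω^ω` is arithmetical if it is `Σ⁰_{k+1}` for some `k`. -/
def IsArithmetical (P : ℕ → (ℕ → ℕ) → Prop) : Prop := ∃ k, SigmaZero k P

/-- A set `A ⊆ ω` is (lightface) `Π¹₁` if it is defined by a universal function quantifier
followed by an arithmetical relation. -/
def IsPiOneOne (A : Set ℕ) : Prop :=
  ∃ P, IsArithmetical P ∧ ∀ n, n ∈ A ↔ ∀ h : ℕ → ℕ, P n h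

/-! A Π¹₁ set has the form "every `H` meets a primitive recursive bar `B n`". For each `n ∉ A` fix a
path `p n` missing the bar, and let `f` hold `p n` in its `n`-th column. If `g ≥ f`, the functions
bounded by the `n`-th column of `g` include `p n`, so they all meet the bar exactly when `n ∈ A`. By
compactness they then do so below a fixed level, which makes this c.e. in `g`
(`exists_uniform_bar`).

Conversely, given a modulus, `n ∈ A` iff every `e` has some `g ≥ e` with `n ∈ Θ(g)`: take `max e f`
one way and `e = f` the other. Only a finite part of `g` is used, so the inner clause is c.e. in `e`
(`RelCEOperator.exists_above`). -/

section PrimrecClosure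

variable {α : Type*} [Primcodable α]

theorem PrimrecPred.exists_lt_of_primrec {f : α → ℕ} {p : α → ℕ → Prop} (hf : Primrec f)
    (hp : PrimrecPred fun q : α × ℕ => p q.1 q.2) : PrimrecPred fun a => ∃ x < f a, p a x :=
  have h : PrimrecRel fun x a => p a x := PrimrecRel.swap (r := p) hp
  (h.exists_mem_list.comp (Primrec.list_range.comp hf) Primrec.id).of_eq fun a => by simp

theorem PrimrecPred.forall_lt_of_primrec {f : α → ℕ} {p : α → ℕ → Prop} (hf : Primrec f)
    (hp : PrimrecPred fun q : α × ℕ => p q.1 q.2) : PrimrecPred fun a => ∀ x < f a, p a x :=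
  have h : PrimrecRel fun x a => p a x := PrimrecRel.swap (r := p) hp
  (h.forall_mem_list.comp (Primrec.list_range.comp hf) Primrec.id).of_eq fun a => by simp

theorem PrimrecPred.forall_mem_of_primrec {β : Type*} [Primcodable β] {f : α → List β}
    {p : α → β → Prop} (hf : Primrec f) (hp : PrimrecPred fun q : α × β => p q.1 q.2) :
    PrimrecPred fun a => ∀ x ∈ f a, p a x :=
  have h : PrimrecRel fun x a => p a x := PrimrecRel.swap (r := p) hp
  h.forall_mem_list.comp hf Primrec.id

theorem PrimrecPred.rePred {p : α → Prop} (hp : PrimrecPred p) : REPred p := by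
  obtain ⟨hd, hp⟩ := hp
  exact ComputablePred.to_re ⟨hd, hp.to_comp⟩

/-- Every computably enumerable predicate has a primitive recursive enumeration by stages. -/
theorem REPred.exists_stage {p : α → Prop} (hp : REPred p) :
    ∃ R : α → ℕ → Prop, (PrimrecPred fun q : α × ℕ => R q.1 q.2) ∧ ∀ a, p a ↔ ∃ s, R a s := by
  obtain ⟨c, hc⟩ := Nat.Partrec.Code.exists_code.1 hp
  refine ⟨fun a s => (c.evaln s (Encodable.encode a)).isSome = true, ?_, fun a => ?_⟩
  · refine ⟨inferInstance, ?_⟩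
    have h : Primrec fun q : α × ℕ => (c.evaln q.2 (Encodable.encode q.1)).isSome :=
      Primrec.option_isSome.comp (Nat.Partrec.Code.primrec_evaln.comp
        (Primrec.pair (Primrec.pair Primrec.snd (Primrec.const c))
          (Primrec.encode.comp Primrec.fst)))
    exact h.of_eq fun q => by simp
  · have hdom : p a ↔ (c.eval (Encodable.encode a)).Dom := by
      rw [hc]
      simp [Part.bind, Part.assert]
    rw [hdom, Part.dom_iff_mem]
    simp only [Nat.Partrec.Code.evaln_complete, Option.isSome_iff_exists, Option.mem_def]
    exact exists_comm

end PrimrecClosure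

section InitSeg

variable (g : ℕ → ℕ) (k : ℕ)

@[simp] theorem length_initSeg : (initSeg g k).length = k := by simp [initSeg]

theorem initSeg_map (φ : ℕ → ℕ) : (initSeg g k).map φ = initSeg (fun i => φ (g i)) k := by
  simp [initSeg, Function.comp_def]

theorem take_initSeg {j k : ℕ} (h : j ≤ k) : (initSeg g k).take j = initSeg g j := by
  simp [initSeg, ← List.map_take, List.take_range, h]

theorem getD_initSeg {i k : ℕ} (h : i < k) (d : ℕ) : (initSeg g k).getD i d = g i := by
  simp [initSeg, List.getD, h]

theorem initSeg_succ : initSeg g (k + 1) = g 0 :: initSeg (fun i => g (i + 1)) k := by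
  simp [initSeg, List.range_succ_eq_map, Function.comp_def]

theorem initSeg_congr {g h : ℕ → ℕ} {k : ℕ} (H : ∀ i < k, g i = h i) :
    initSeg g k = initSeg h k :=
  List.map_congr_left fun i hi => H i (List.mem_range.1 hi)

theorem initSeg_getD (σ : List ℕ) (d : ℕ) {j : ℕ} (h : j ≤ σ.length) :
    initSeg (fun i => σ.getD i d) j = σ.take j := by
  refine List.ext_getElem (by simp [h]) fun i h₁ h₂ => ?_
  have hi : i < σ.length := by simp at h₂; omega
  simp [initSeg, hi]

end InitSeg

/-! ### Normal form for arithmetical relations -/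

/-- `P` is defined by a universal function quantifier followed by an existential number quantifier
and a primitive recursive relation of finite initial segments. -/
def IsUnivExists (P : ℕ → (ℕ → ℕ) → Prop) : Prop :=
  ∃ R : ℕ → List ℕ → List ℕ → Prop,
    (PrimrecPred fun q : ℕ × List ℕ × List ℕ => R q.1 q.2.1 q.2.2) ∧
      ∀ n h, P n h ↔ ∀ g, ∃ k, R n (initSeg h k) (initSeg g k)

theorem RelCEOperator.exists_stage (Θ : RelCEOperator) :
    ∃ R : List ℕ × ℕ → ℕ → Prop, (PrimrecPred fun q : (List ℕ × ℕ) × ℕ => R q.1 q.2) ∧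
      ∀ h n, n ∈ Θ.eval h ↔ ∃ k s, R (initSeg h k, n) s := by
  obtain ⟨R, hR, H⟩ := Θ.ce.exists_stage
  exact ⟨R, hR, fun h n => exists_congr fun k => H _⟩

open Primrec in
theorem RelCEOperator.isUnivExists (Θ : RelCEOperator) : IsUnivExists fun n h => n ∈ Θ.eval h := by
  obtain ⟨R, hR, H⟩ := Θ.exists_stage
  refine ⟨fun n σ _ => ∃ j < σ.length + 1, ∃ s < σ.length, R (σ.take j, n) s, ?_, fun n h => ?_⟩
  · have hσ : Primrec fun q : ℕ × List ℕ × List ℕ => q.2.1 := fst.comp snd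
    have hlen := list_length.comp hσ
    refine .exists_lt_of_primrec (succ.comp hlen) (.exists_lt_of_primrec (hlen.comp fst) ?_)
    exact hR.comp (.pair (.pair (list_take.comp (snd.comp fst) (hσ.comp (fst.comp fst)))
      (fst.comp (fst.comp fst))) snd)
  · simp only [H]
    constructor
    · rintro ⟨k, s, hs⟩ -
      refine ⟨k + s + 1, k, by rw [length_initSeg]; omega, s, by rw [length_initSeg]; omega, ?_⟩
      rwa [take_initSeg _ (by omega)]
    · intro hall
      obtain ⟨k, j, hj, s, -, hs⟩ := hall 0
      rw [length_initSeg] at hj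
      rw [take_initSeg _ (by omega)] at hs
      exact ⟨j, s, hs⟩

-- The entry `g 0` codes an alleged prefix length and stage of enumeration, which the matrix
-- refutes.
open Primrec in
theorem RelCEOperator.isUnivExists_not (Θ : RelCEOperator) :
    IsUnivExists fun n h => ¬ n ∈ Θ.eval h := by
  obtain ⟨R, hR, H⟩ := Θ.exists_stage
  refine ⟨fun n σ τ => 0 < τ.length ∧ τ.headI.unpair.1 ≤ σ.length ∧
    ¬ R (σ.take τ.headI.unpair.1, n) τ.headI.unpair.2, ?_, fun n h => ?_⟩
  · have hσ : Primrec fun q : ℕ × List ℕ × List ℕ => q.2.1 := fst.comp snd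
    have hτ : Primrec fun q : ℕ × List ℕ × List ℕ => q.2.2 := snd.comp snd
    have hv := unpair.comp (list_headI.comp hτ)
    exact (nat_lt.comp (const 0) (list_length.comp hτ)).and
      ((nat_le.comp (fst.comp hv) (list_length.comp hσ)).and
        (hR.comp (.pair (.pair (list_take.comp (fst.comp hv) hσ) fst) (snd.comp hv))).not)
  · simp only [H]
    constructor
    · intro hn g
      refine ⟨(g 0).unpair.1 + 1, ?_⟩
      rw [initSeg_succ g]
      simp only [List.headI_cons, length_initSeg, List.length_cons]
      refine ⟨by omega, by omega, fun hs => hn ⟨(g 0).unpair.1, (g 0).unpair.2, ?_⟩⟩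
      rwa [take_initSeg _ (by omega)] at hs
    · rintro hall ⟨j, s, hs⟩
      obtain ⟨k, hk, hle, hns⟩ := hall fun _ => Nat.pair j s
      obtain _ | k := k
      · simp at hk
      · rw [initSeg_succ fun _ => Nat.pair j s] at hle hns
        simp only [List.headI_cons, length_initSeg, Nat.unpair_pair] at hle hns
        rw [take_initSeg _ hle] at hns
        exact hns hs

theorem IsUnivExists.congr {P Q : ℕ → (ℕ → ℕ) → Prop} (hP : IsUnivExists P)
    (H : ∀ n h, Q n h ↔ P n h) : IsUnivExists Q := by
  obtain ⟨R, hR, HR⟩ := hP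
  exact ⟨R, hR, fun n h => (H n h).trans (HR n h)⟩

-- The number quantifier is absorbed into the function quantifier as a new first entry of `g`.
open Primrec in
theorem IsUnivExists.forall_nat {P : ℕ → (ℕ → ℕ) → Prop} (hP : IsUnivExists P) :
    IsUnivExists fun n h => ∀ m, P (Nat.pair n m) h := by
  obtain ⟨R, hR, H⟩ := hP
  refine ⟨fun n σ τ => 0 < τ.length ∧
    R (Nat.pair n τ.headI) (σ.take τ.tail.length) τ.tail, ?_, fun n h => ?_⟩
  · have hσ : Primrec fun q : ℕ × List ℕ × List ℕ => q.2.1 := fst.comp snd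
    have hτ : Primrec fun q : ℕ × List ℕ × List ℕ => q.2.2 := snd.comp snd
    have ht := list_tail.comp hτ
    exact (nat_lt.comp (const 0) (list_length.comp hτ)).and
      (hR.comp (.pair (Primrec₂.natPair.comp fst (list_headI.comp hτ))
        (.pair (list_take.comp (list_length.comp ht) hσ) ht)))
  · simp only [H]
    constructor
    · intro hall g
      obtain ⟨k, hk⟩ := hall (g 0) fun i => g (i + 1)
      refine ⟨k + 1, ?_⟩
      rw [initSeg_succ g]
      simpa [take_initSeg] using hk
    · intro hall m g
      obtain ⟨k, hk, hR⟩ := hall fun i => Nat.casesOn i m g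
      obtain _ | k := k
      · simp at hk
      · rw [initSeg_succ fun i => Nat.casesOn i m g] at hR
        exact ⟨k, by simpa [take_initSeg] using hR⟩

open Primrec in
theorem IsUnivExists.exists_nat {P : ℕ → (ℕ → ℕ) → Prop} (hP : IsUnivExists P) :
    IsUnivExists fun n h => ∃ m, P (Nat.pair n m) h := by
  obtain ⟨R, hR, H⟩ := hP
  refine ⟨fun n σ τ => ∃ m < τ.length, ∃ k < τ.length, Nat.pair m k < τ.length ∧
    R (Nat.pair n m) (σ.take k) ((List.range k).map fun i => τ.getD (Nat.pair m i) 0),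
    ?_, fun n h => ?_⟩
  · have hlen : Primrec fun q : ℕ × List ℕ × List ℕ => q.2.2.length :=
      list_length.comp (snd.comp snd)
    refine .exists_lt_of_primrec hlen (.exists_lt_of_primrec (hlen.comp fst) ?_)
    have hn : Primrec fun q : ((ℕ × List ℕ × List ℕ) × ℕ) × ℕ => q.1.1.1 :=
      fst.comp (fst.comp fst)
    have hσ : Primrec fun q : ((ℕ × List ℕ × List ℕ) × ℕ) × ℕ => q.1.1.2.1 :=
      fst.comp (snd.comp (fst.comp fst))
    have hτ : Primrec fun q : ((ℕ × List ℕ × List ℕ) × ℕ) × ℕ => q.1.1.2.2 :=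
      snd.comp (snd.comp (fst.comp fst))
    have hm : Primrec fun q : ((ℕ × List ℕ × List ℕ) × ℕ) × ℕ => q.1.2 := snd.comp fst
    refine (nat_lt.comp (Primrec₂.natPair.comp hm snd) (list_length.comp hτ)).and
      (hR.comp (.pair (Primrec₂.natPair.comp hn hm) (.pair (list_take.comp snd hσ)
        (list_map (list_range.comp snd) ?_))))
    exact (list_getD 0).comp (hτ.comp fst) (Primrec₂.natPair.comp (hm.comp fst) snd)
  · have key : ∀ (g : ℕ → ℕ) (m k K : ℕ), Nat.pair m k < K →
        ((List.range k).map fun i => (initSeg g K).getD (Nat.pair m i) 0) =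
          initSeg (fun i => g (Nat.pair m i)) k := fun g m k K hK =>
      List.map_congr_left fun i hi => getD_initSeg _
        ((Nat.pair_lt_pair_right m (List.mem_range.1 hi)).trans hK) _
    simp only [H, length_initSeg]
    constructor
    · rintro ⟨m, hall⟩ g
      obtain ⟨k, hk⟩ := hall fun i => g (Nat.pair m i)
      have h₁ := Nat.left_le_pair m k
      have h₂ := Nat.right_le_pair m k
      refine ⟨Nat.pair m k + 1, m, by omega, k, by omega, by omega, ?_⟩
      rwa [key _ _ _ _ (Nat.lt_succ_self _), take_initSeg _ (by omega)]
    · intro hall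
      by_contra! hne
      choose G hG using hne
      obtain ⟨K, m, -, k, hkK, hK, hk⟩ := hall fun i => G i.unpair.1 i.unpair.2
      rw [key _ _ _ _ hK, take_initSeg _ hkK.le] at hk
      simp only [Nat.unpair_pair] at hk
      exact hG m k hk

/-- Each level negates the previous one, so the induction must carry the relation together with its
negation. -/
theorem SigmaZero.isUnivExists {k : ℕ} {P : ℕ → (ℕ → ℕ) → Prop} (hP : SigmaZero k P) :
    IsUnivExists P ∧ IsUnivExists fun n h => ¬ P n h := by
  induction k generalizing P with
  | zero =>
    obtain ⟨Θ, H⟩ := hP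
    exact ⟨Θ.isUnivExists.congr H, Θ.isUnivExists_not.congr fun n h => not_congr (H n h)⟩
  | succ k ih =>
    obtain ⟨Q, hQ, H⟩ := hP
    exact ⟨(ih hQ).2.exists_nat.congr H,
      (ih hQ).1.forall_nat.congr fun n h => by rw [H]; push Not; rfl⟩

/-! ### Bounded strings and compactness -/

/-- The list of all strings of the same length as `b` that are bounded by `b` pointwise. -/
def boundedLists (b : List ℕ) : List (List ℕ) := (b.map fun c => List.range (c + 1)).sections

theorem mem_boundedLists {b ρ : List ℕ} : ρ ∈ boundedLists b ↔ List.Forall₂ (· ≤ ·) ρ b := by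
  simp [boundedLists, List.mem_sections, List.forall₂_map_right_iff]

theorem mem_boundedLists_initSeg {b : ℕ → ℕ} {ℓ : ℕ} {ρ : List ℕ} :
    ρ ∈ boundedLists (initSeg b ℓ) ↔ ∃ H : ℕ → ℕ, (∀ i, H i ≤ b i) ∧ ρ = initSeg H ℓ := by
  rw [mem_boundedLists]
  constructor
  · intro h
    have hlen : ρ.length = ℓ := by simpa using h.length_eq
    refine ⟨fun i => ρ.getD i 0, fun i => ?_, ?_⟩
    · by_cases hi : i < ρ.length
      · have := List.Forall₂.get h hi (by simp; omega)
        simpa [initSeg, hi] using this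
      · simp [List.getD, List.getElem?_eq_none (not_lt.1 hi)]
    · rw [initSeg_getD _ _ hlen.ge, ← hlen, List.take_length]
  · rintro ⟨H, hH, rfl⟩
    simp [initSeg, List.forall₂_map_left_iff, List.forall₂_map_right_iff, List.forall₂_same, hH]

open Primrec in
theorem primrec_boundedLists : Primrec boundedLists := by
  have h : Primrec fun b : List ℕ => b.foldr
      (fun c (acc : List (List ℕ)) =>
        acc.flatMap fun s => (List.range (c + 1)).map fun a => a :: s) [[]] := by
    refine list_foldr (h := fun _ p => p.2.flatMap fun s =>
      (List.range (p.1 + 1)).map fun a => a :: s) Primrec.id (const [[]]) ?_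
    refine list_flatMap (snd.comp snd) (list_map (list_range.comp (succ.comp
      (fst.comp (snd.comp fst)))) ?_)
    exact list_cons.comp snd (snd.comp fst)
  refine h.of_eq fun b => ?_
  induction b with
  | nil => rfl
  | cons c b ih => simp only [List.foldr_cons, ih]; rfl

/-- A bar for the functions bounded by `b` is uniform. -/
theorem exists_uniform_bar {b : ℕ → ℕ} {B : List ℕ → Prop}
    (hB : ∀ H : ℕ → ℕ, (∀ i, H i ≤ b i) → ∃ k, B (initSeg H k)) :
    ∃ ℓ, ∀ H : ℕ → ℕ, (∀ i, H i ≤ b i) → ∃ k ≤ ℓ, B (initSeg H k) := by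
  have hs : IsCompact (Set.univ.pi fun i => Set.Iic (b i)) :=
    isCompact_univ_pi fun i => (Set.finite_Iic (b i)).isCompact
  let U : ℕ → Set (ℕ → ℕ) := fun ℓ => {H | ∃ k ≤ ℓ, B (initSeg H k)}
  have hopen : ∀ ℓ, IsOpen (U ℓ) := by
    refine fun ℓ => isOpen_iff_mem_nhds.2 fun H ⟨k, hk, hb⟩ => ?_
    have hcyl : IsOpen ((Set.Iio k).pi fun i => ({H i} : Set ℕ)) :=
      isOpen_set_pi (Set.finite_Iio k) fun i _ => isOpen_discrete _
    refine Filter.mem_of_superset (hcyl.mem_nhds fun i _ => rfl) fun G hG => ⟨k, hk, ?_⟩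
    rwa [initSeg_congr fun i hi => hG i hi]
  have hcover : (Set.univ.pi fun i => Set.Iic (b i)) ⊆ ⋃ ℓ, U ℓ := fun H hH => by
    obtain ⟨k, hk⟩ := hB H fun i => hH i trivial
    exact Set.mem_iUnion.2 ⟨k, k, le_rfl, hk⟩
  have hmono : Monotone U := fun i j hij H ⟨k, hk, hb⟩ => ⟨k, hk.trans hij, hb⟩
  obtain ⟨ℓ, hℓ⟩ := hs.elim_directed_cover U hopen hcover hmono.directed_le
  exact ⟨ℓ, fun H hH => hℓ fun i _ => hH i⟩

/-! ### From Π¹₁ to a modulus -/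

open Primrec in
theorem IsPiOneOne.exists_primrecPred {A : Set ℕ} (hA : IsPiOneOne A) :
    ∃ B : ℕ → List ℕ → Prop, (PrimrecPred fun q : ℕ × List ℕ => B q.1 q.2) ∧
      ∀ n, n ∈ A ↔ ∀ H : ℕ → ℕ, ∃ k, B n (initSeg H k) := by
  obtain ⟨P, ⟨k, hP⟩, HA⟩ := hA
  obtain ⟨R, hR, H⟩ := hP.isUnivExists.1
  refine ⟨fun n ρ => R n (ρ.map fun i => i.unpair.1) (ρ.map fun i => i.unpair.2), ?_,
    fun n => ?_⟩
  · exact hR.comp (.pair fst (.pair (list_map snd (fst.comp (unpair.comp snd)).to₂)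
      (list_map snd (snd.comp (unpair.comp snd)).to₂)))
  · simp only [HA, H, initSeg_map]
    refine ⟨fun h G => h _ _, fun h f g => ?_⟩
    simpa using h fun i => Nat.pair (f i) (g i)

open Primrec in
theorem IsPiOneOne.exists_modulus {A : Set ℕ} (hA : IsPiOneOne A) :
    ∃ (f : ℕ → ℕ) (Θ : RelCEOperator), ∀ g : ℕ → ℕ, (∀ n, f n ≤ g n) → Θ.eval g = A := by
  obtain ⟨B, hB, HA⟩ := hA.exists_primrecPred
  have hpath : ∀ n, ∃ p : ℕ → ℕ, n ∉ A → ∀ k, ¬ B n (initSeg p k) := by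
    intro n
    by_cases hn : n ∈ A
    · exact ⟨0, fun h => (h hn).elim⟩
    · rw [HA] at hn
      push Not at hn
      exact hn.imp fun p hp _ => hp
  choose p hp using hpath
  -- The bound on `Nat.pair q.2 ℓ` puts the first `ℓ` column entries inside the string, so the
  -- default 0 is never read.
  let S : List ℕ × ℕ → Prop := fun q => ∃ ℓ < q.1.length, Nat.pair q.2 ℓ < q.1.length ∧
    ∀ ρ ∈ boundedLists ((List.range ℓ).map fun i => q.1.getD (Nat.pair q.2 i) 0),
      ∃ k < ℓ + 1, B q.2 (ρ.take k)
  have hS : PrimrecPred S := by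
    refine .exists_lt_of_primrec (list_length.comp fst) (.and ?_ (.forall_mem_of_primrec
      (primrec_boundedLists.comp (list_map (list_range.comp snd) ?_))
      (.exists_lt_of_primrec (succ.comp (snd.comp fst)) ?_)))
    · exact nat_lt.comp (Primrec₂.natPair.comp (snd.comp fst) snd)
        (list_length.comp (fst.comp fst))
    · exact (list_getD 0).comp (fst.comp (fst.comp fst))
        (Primrec₂.natPair.comp (snd.comp (fst.comp fst)) snd)
    · exact hB.comp (.pair (snd.comp (fst.comp (fst.comp fst)))
        (list_take.comp snd (snd.comp fst)))
  have key : ∀ (g : ℕ → ℕ) (n ℓ K : ℕ), Nat.pair n ℓ < K →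
      ((List.range ℓ).map fun i => (initSeg g K).getD (Nat.pair n i) 0) =
        initSeg (fun i => g (Nat.pair n i)) ℓ := fun g n ℓ K hK =>
    List.map_congr_left fun i hi => getD_initSeg _
      ((Nat.pair_lt_pair_right n (List.mem_range.1 hi)).trans hK) _
  refine ⟨fun i => p i.unpair.1 i.unpair.2, ⟨{q | S q}, hS.rePred⟩, fun g hg => ?_⟩
  ext n
  constructor
  · rintro ⟨K, ℓ, -, hK, hbar⟩
    by_contra hn
    simp only [length_initSeg] at hK
    simp only [key _ _ _ _ hK] at hbar
    obtain ⟨k, hk, hb⟩ := hbar (initSeg (p n) ℓ) (mem_boundedLists_initSeg.2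
      ⟨p n, fun i => by simpa using hg (Nat.pair n i), rfl⟩)
    rw [take_initSeg _ (by omega)] at hb
    exact hp n hn k hb
  · intro hn
    obtain ⟨ℓ, hℓ⟩ := exists_uniform_bar (b := fun i => g (Nat.pair n i)) (B := B n)
      fun H _ => (HA n).1 hn H
    have h₂ := Nat.right_le_pair n ℓ
    refine ⟨Nat.pair n ℓ + 1, ℓ, by simp; omega, by simp, fun ρ hρ => ?_⟩
    rw [key _ _ _ _ (Nat.lt_succ_self _)] at hρ
    obtain ⟨H, hH, rfl⟩ := mem_boundedLists_initSeg.1 hρ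
    obtain ⟨k, hk, hb⟩ := hℓ H hH
    exact ⟨k, by omega, by rwa [take_initSeg _ hk]⟩

/-! ### From a modulus to Π¹₁ -/

open Primrec in
/-- From a relative c.e. operator one obtains another that enumerates `n` from `f` if and only if
the given one enumerates `n` from some function above `f`. -/
theorem RelCEOperator.exists_above (Θ : RelCEOperator) :
    ∃ Ψ : RelCEOperator, ∀ f n, n ∈ Ψ.eval f ↔ ∃ g : ℕ → ℕ, (∀ i, f i ≤ g i) ∧ n ∈ Θ.eval g := by
  obtain ⟨R, hR, H⟩ := Θ.exists_stage
  let above : List ℕ → List ℕ → Prop := fun τ σ => σ.length ≤ τ.length ∧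
    ∀ i < σ.length, τ.getD i 0 ≤ σ.getD i 0
  let S : List ℕ × ℕ → Prop := fun q => ∃ c < q.1.length, ∃ s < q.1.length,
    above q.1 ((Encodable.decode (α := List ℕ) c).getD []) ∧
      R ((Encodable.decode (α := List ℕ) c).getD [], q.2) s
  have habove : PrimrecPred fun q : List ℕ × List ℕ => above q.1 q.2 :=
    (nat_le.comp (list_length.comp snd) (list_length.comp fst)).and
      (.forall_lt_of_primrec (list_length.comp snd)
        (nat_le.comp ((list_getD 0).comp (fst.comp fst) snd)
          ((list_getD 0).comp (snd.comp fst) snd)))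
  have hS : PrimrecPred S := by
    have hlen : Primrec fun q : List ℕ × ℕ => q.1.length := list_length.comp fst
    have hdec : Primrec fun q : ((List ℕ × ℕ) × ℕ) × ℕ =>
        (Encodable.decode (α := List ℕ) q.1.2).getD [] :=
      option_getD.comp (Primrec.decode.comp (snd.comp fst)) (const [])
    refine .exists_lt_of_primrec hlen (.exists_lt_of_primrec (hlen.comp fst) (.and ?_ ?_))
    · exact habove.comp (.pair (fst.comp (fst.comp fst)) hdec)
    · exact hR.comp (.pair (.pair hdec (snd.comp (fst.comp fst))) snd)
  refine ⟨⟨{q | S q}, hS.rePred⟩, fun f n => ?_⟩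
  constructor
  · rintro ⟨K, c, -, s, -, ⟨hlen, hle⟩, hs⟩
    revert hlen hle hs
    generalize (Encodable.decode (α := List ℕ) c).getD [] = σ
    intro hs hlen hle
    rw [length_initSeg] at hlen
    -- Past `σ`, continuing with `f` itself stays above `f`.
    refine ⟨fun i => if i < σ.length then σ.getD i 0 else f i, fun i => ?_, ?_⟩
    · dsimp only
      split_ifs with hi
      · have := hle i hi
        rwa [getD_initSeg _ (hi.trans_le hlen)] at this
      · exact le_rfl
    · rw [H]
      refine ⟨σ.length, s, ?_⟩
      rw [initSeg_congr (h := fun i => σ.getD i 0) fun i hi => by rw [if_pos hi],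
        initSeg_getD _ _ le_rfl, List.take_length]
      exact hs
  · rintro ⟨g, hfg, hg⟩
    obtain ⟨k, s, hs⟩ := (H g n).1 hg
    -- The prefix of `f` must be longer than the code of the string and the stage, and cover its
    -- length.
    refine ⟨Encodable.encode (initSeg g k) + s + k + 1, Encodable.encode (initSeg g k),
      by simp; omega, s, by simp; omega, ?_⟩
    simp only [Encodable.encodek, Option.getD_some]
    refine ⟨⟨by simp; omega, fun i hi => ?_⟩, hs⟩
    rw [length_initSeg] at hi
    rw [getD_initSeg _ hi, getD_initSeg _ (by omega)]
    exact hfg i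

theorem isPiOneOne_of_modulus {A : Set ℕ} {f : ℕ → ℕ} {Θ : RelCEOperator}
    (h : ∀ g : ℕ → ℕ, (∀ n, f n ≤ g n) → Θ.eval g = A) : IsPiOneOne A := by
  obtain ⟨Ψ, hΨ⟩ := Θ.exists_above
  refine ⟨fun n h => n ∈ Ψ.eval h, ⟨0, Ψ, fun _ _ => Iff.rfl⟩, fun n => ?_⟩
  simp only [hΨ]
  constructor
  · intro hn e
    refine ⟨fun i => max (e i) (f i), fun i => le_max_left _ _, ?_⟩
    rwa [h _ fun i => le_max_right _ _]
  · intro hall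
    obtain ⟨g, hfg, hg⟩ := hall f
    rwa [h g hfg] at hg

theorem mainTheorem10 (A : Set ℕ) :
    IsPiOneOne A ↔
      ∃ (f : ℕ → ℕ) (Θ : RelCEOperator), ∀ g : ℕ → ℕ, (∀ n, f n ≤ g n) → Θ.eval g = A :=
  ⟨IsPiOneOne.exists_modulus, fun ⟨_, _, h⟩ => isPiOneOne_of_modulus h⟩
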